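/- Let $N\ge 3$ be an integer, $m>0$ and $b\ge 0$ be real numbers, and let $d\mu=e^{-b|x|^m}\,dx$ on $\mathbb{R}^N$. Let $H^1_\mu$ be the space of real-valued functions $u\in L^2(\mathbb{R}^N,d\mu)$ whose weak first-order derivatives belong to $L^2(\mathbb{R}^N,d\mu)$, and put $c_0(N)=\left(\frac{N-2}{2}\right)^2$. Then: (i) there exists a constant $C>0$ (depending on $N,m,b$ only) such that for every $u\in H^1_\mu$ the function $u^2/|x|^2$ is $\mu$-integrable and $$c_0(N)\int_{\mathbb{R}^N}\frac{u^2}{|x|^2}\,d\mu\le\int_{\mathbb{R}^N}|\nabla u|^2\,d\mu+C\int_{\mathbb{R}^N}u^2\,d\mu ;$$ (ii) the constant $c_0(N)$ is the best possible: for every $c>c_0(N)$ and every $C\in\mathbb{R}$ there is $u\in H^1_\mu$ with $u^2/|x|^2$ $\mu$-integrable and $$c\int_{\mathbb{R}^N}\frac{u^2}{|x|^2}\,d\mu>\int_{\mathbb{R}^N}|\nabla u|^2\,d\mu+C\int_{\mathbb{R}^N}u^2\,d\mu .$$ -/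

import Mathlib

open MeasureTheory
open scoped ContDiff

noncomputable section

/-- `g` is the weak gradient of `u` on `ℝ^N`: both are locally integrable and
`∫ u ∂ᵢφ dx = - ∫ gᵢ φ dx` for every test function `φ ∈ C_c^∞(ℝ^N)` and every `i`. -/
structure HasWeakGradient {N : ℕ} (u : EuclideanSpace ℝ (Fin N) → ℝ)
    (g : EuclideanSpace ℝ (Fin N) → EuclideanSpace ℝ (Fin N)) : Prop where
  locallyIntegrable : LocallyIntegrable u volume
  locallyIntegrable_grad : LocallyIntegrable g volume
  integral_eq : ∀ φ : EuclideanSpace ℝ (Fin N) → ℝ, ContDiff ℝ ∞ φ → HasCompactSupport φ →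
    ∀ i : Fin N,
      ∫ x, u x * fderiv ℝ φ x (EuclideanSpace.single i (1 : ℝ)) = - ∫ x, g x i * φ x

/-- `u` belongs to the weighted Sobolev space `H^1_μ = H^1(ℝ^N, dμ)` and `g` is (a version of)
its weak gradient: `u` and all its weak first derivatives belong to `L^2_μ`. -/
structure MemH1WithGradient {N : ℕ} (μ : Measure (EuclideanSpace ℝ (Fin N)))
    (u : EuclideanSpace ℝ (Fin N) → ℝ)
    (g : EuclideanSpace ℝ (Fin N) → EuclideanSpace ℝ (Fin N)) : Prop where
  hasWeakGradient : HasWeakGradient u g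
  memLp : MemLp u 2 μ
  memLp_grad : MemLp g 2 μ

/-- The measure `dμ = e^{-b|x|^m} dx` on `ℝ^N`. -/
def expPowerMeasure (N : ℕ) (b m : ℝ) : Measure (EuclideanSpace ℝ (Fin N)) :=
  volume.withDensity fun x => ENNReal.ofReal (Real.exp (-b * ‖x‖ ^ m))

/-- The Hardy constant `c₀(N) = ((N - 2) / 2)^2`. -/
def hardyConst (N : ℕ) : ℝ := (((N : ℝ) - 2) / 2) ^ 2

end

/-! Write `l = (N-2)/2`, `s = |x|²`, `t = s + ε` and `W` for the weight as a function of the squared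
norm. For a compactly supported field `F = Q(t) x`, the weak divergence theorem gives `∫ (u² div F +
2u F·g) dx = 0`. Completing the square in `W|g|² + 2u F·g` then yields `∫ W|g|² ≥ ∫ u² (div F -
|F|²/W)`. So (i) reduces to a scalar inequality, `div F - |F|²/W ≥ l² W(t)/t - C W(s)`, supplied by
`exists_radial_profile`. The classical choice `Q = l/t` handles `W = 1`. Near the origin `1 - W =
O(t^{m/2})`, and this deviation enters only through its square, of order `t^m`, so the correction `Q
= l (1/t + A t^{m-1})` absorbs it for suitable `A`. Away from the origin a cutoff and the constant
`C` do the rest. The shift `ε` keeps the field smooth at the origin and is removed by Fatou. The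
divergence identity needs the product rule for `u²` with `u` merely weakly differentiable
(`integral_sq_mul_fderiv`).

For (ii), the test functions are `P(|x|² + ε)` with `P = t^{-l/2}` cut off. If the inequality held
with some `c > l²`, then `∫ u²/|x|² dμ` would be bounded uniformly in `ε`, and Fatou would make
`|x|^{-N}` integrable at the origin. -/

/-! ### Product rule for the square of a weakly differentiable function -/

section Mollification

open Filter Topology Convolution ContinuousLinearMap

variable {E : Type*} [NormedAddCommGroup E] [InnerProductSpace ℝ E] [FiniteDimensional ℝ E]
  [MeasurableSpace E] [BorelSpace E]

/-- The correlation of two `L²` functions is continuous. -/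
theorem continuous_integral_mul_comp_sub {k h : E → ℝ} (hk : MemLp k 2 volume)
    (hh : MemLp h 2 volume) : Continuous fun t => ∫ x, k x * h (x - t) := by
  have hmp : ∀ t : E, MeasurePreserving (fun x : E => x - t) volume volume := fun t =>
    measurePreserving_sub_right volume t
  let τ : E → C(E, E) := fun t => ⟨fun x => x - t, by fun_prop⟩
  have hτ : Continuous τ := ContinuousMap.continuous_of_continuous_uncurry _ (by
    change Continuous fun p : E × E => p.2 - p.1
    fun_prop)
  have hcont : Continuous fun t =>
      Lp.compMeasurePreserving (τ t) (hmp t) (hh.toLp h) :=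
    Continuous.compMeasurePreservingLp continuous_const hτ hmp (by simp)
  have hinner := (continuous_const (y := hk.toLp k)).inner (𝕜 := ℝ) hcont
  convert hinner using 2 with t
  rw [L2.inner_def]
  refine integral_congr_ae ?_
  rw [Lp.toLp_compMeasurePreserving]
  filter_upwards [hk.coeFn_toLp, (hh.comp_measurePreserving (hmp t)).coeFn_toLp] with x h1 h2
  have h2' : ((hh.comp_measurePreserving (hmp t)).toLp _ : E → ℝ) x = h (x - t) := h2
  change _ = inner ℝ _ (((hh.comp_measurePreserving (hmp t)).toLp _ : E → ℝ) x)
  rw [h1, h2']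
  simp [mul_comm]

theorem integral_mul_convolution_eq {ρ k h : E → ℝ} (hρ : Integrable ρ volume)
    (hk : MemLp k 2 volume) (hh : MemLp h 2 volume) :
    ∫ x, k x * (ρ ⋆[lsmul ℝ ℝ, volume] h) x = ∫ t, ρ t * ∫ x, k x * h (x - t) := by
  -- Fubini is justified by `|k ρ h| ≤ k² |ρ| + |ρ| h²`, whose two terms are integrable on the
  -- product because `k²`, `h²` and `ρ` are.
  have hint : Integrable (fun p : E × E => k p.1 * (ρ p.2 * h (p.1 - p.2)))
      (volume.prod volume) := by
    have h1 : Integrable (fun p : E × E => k p.1 ^ 2 * ‖ρ p.2‖) (volume.prod volume) :=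
      hk.integrable_sq.mul_prod hρ.norm
    have h2 : Integrable (fun p : E × E => ‖ρ p.2‖ * h (p.1 - p.2) ^ 2) (volume.prod volume) :=
      hρ.norm.convolution_integrand (lsmul ℝ ℝ) hh.integrable_sq
    refine (h1.add h2).mono' ?_ (Eventually.of_forall fun p => ?_)
    · exact hk.1.comp_fst.mul (hρ.1.convolution_integrand (lsmul ℝ ℝ) hh.1)
    · simp only [norm_mul, Pi.add_apply]
      have := abs_nonneg (ρ p.2)
      have h3 := two_mul_le_add_sq |k p.1| |h (p.1 - p.2)|
      simp only [Real.norm_eq_abs, sq_abs] at *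
      nlinarith [mul_nonneg this (abs_nonneg (k p.1 * h (p.1 - p.2))),
        abs_mul (k p.1) (h (p.1 - p.2)), abs_nonneg (k p.1), abs_nonneg (h (p.1 - p.2)),
        mul_nonneg (abs_nonneg (k p.1)) (abs_nonneg (h (p.1 - p.2)))]
  calc ∫ x, k x * (ρ ⋆[lsmul ℝ ℝ, volume] h) x
      = ∫ x, ∫ t, k x * (ρ t * h (x - t)) := by
        simp only [convolution_def, lsmul_apply, smul_eq_mul, integral_const_mul]
    _ = ∫ t, ∫ x, k x * (ρ t * h (x - t)) := integral_integral_swap hint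
    _ = _ := by
        congr 1; ext t
        rw [← integral_const_mul]
        congr 1; ext x; ring

/-- By Fubini the integral is an average of the continuous correlation `t ↦ ∫ k(x) h(x - t)` against
an approximate identity, so it tends to the value at `0`. This weak convergence of mollifications is
all that the product rule needs. -/
theorem tendsto_integral_mul_normed_convolution {k h : E → ℝ} (hk : MemLp k 2 volume)
    (hh : MemLp h 2 volume) {ρ : ℕ → ContDiffBump (0 : E)}
    (hρ : Tendsto (fun n => (ρ n).rOut) atTop (𝓝 0)) :
    Tendsto (fun n => ∫ x, k x * ((ρ n).normed volume ⋆[lsmul ℝ ℝ, volume] h) x) atTop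
      (𝓝 (∫ x, k x * h x)) := by
  have hc := continuous_integral_mul_comp_sub hk hh
  have := ContDiffBump.convolution_tendsto_right_of_continuous (μ := (volume : Measure E)) hρ
    (hc.comp continuous_neg) 0
  simp only [convolution_def, Function.comp_def, lsmul_apply, smul_eq_mul, zero_sub, neg_neg,
    neg_zero, sub_zero] at this
  refine this.congr fun n => ?_
  exact (integral_mul_convolution_eq (ρ n).integrable_normed hk hh).symm

/-- Test the weak derivative against `z ↦ ρ (x - z)`: the sign produced by the reflection cancels
the one in the integration by parts. -/
theorem fderiv_convolution_eq_convolution {ρ v f : E → ℝ} {e : E} (hρ : ContDiff ℝ ∞ ρ)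
    (hρc : HasCompactSupport ρ) (hv : LocallyIntegrable v volume)
    (hvf : ∀ φ : E → ℝ, ContDiff ℝ ∞ φ → HasCompactSupport φ →
      ∫ x, v x * fderiv ℝ φ x e = - ∫ x, f x * φ x) (x : E) :
    fderiv ℝ (ρ ⋆[lsmul ℝ ℝ, volume] v) x e = (ρ ⋆[lsmul ℝ ℝ, volume] f) x := by
  have hρ1 : ContDiff ℝ 1 ρ := hρ.of_le (by simp)
  have hd := (hρc.hasFDerivAt_convolution_left (lsmul ℝ ℝ) hρ1 hv x).fderiv
  rw [hd]
  have h1 := hvf (fun z => ρ (x - z)) (hρ.comp (contDiff_const.sub contDiff_id))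
    (hρc.comp_homeomorph (Homeomorph.subLeft x))
  have h2 : ∀ z, fderiv ℝ (fun z => ρ (x - z)) z e = - fderiv ℝ ρ (x - z) e := fun z => by
    have hr : HasFDerivAt ρ (fderiv ℝ ρ (x - z)) (x - z) :=
      (hρ1.differentiable (by simp) _).hasFDerivAt
    rw [HasFDerivAt.fderiv (f := fun z => ρ (x - z)) (hr.comp z ((hasFDerivAt_id z).const_sub x))]
    simp
  simp only [h2, mul_neg, integral_neg, neg_inj] at h1
  rw [convolution_eq_swap, convolution_eq_swap]
  have hex := (hρc.fderiv (𝕜 := ℝ)).convolutionExists_left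
    ((lsmul ℝ ℝ : ℝ →L[ℝ] ℝ →L[ℝ] ℝ).precompL E) (hρ1.continuous_fderiv (by simp)) hv x
  have hex' := hex.integrable_swap
  rw [ContinuousLinearMap.integral_apply hex' e]
  simp only [ContinuousLinearMap.precompL_apply, lsmul_apply, smul_eq_mul]
  simp only [mul_comm] at h1 ⊢
  exact h1

/-- If `f ∈ L²` is the weak derivative of `v ∈ L²` in direction `e`, then `2 v f` is the weak
derivative of `v²`. -/
theorem integral_sq_mul_fderiv_of_memLp {v f : E → ℝ} {e : E} (hv : MemLp v 2 volume)
    (hf : MemLp f 2 volume)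
    (hvf : ∀ φ : E → ℝ, ContDiff ℝ ∞ φ → HasCompactSupport φ →
      ∫ x, v x * fderiv ℝ φ x e = - ∫ x, f x * φ x)
    {φ : E → ℝ} (hφ : ContDiff ℝ ∞ φ) (hφc : HasCompactSupport φ) :
    ∫ x, v x ^ 2 * fderiv ℝ φ x e = - (2 * ∫ x, v x * f x * φ x) := by
  let ρ : ℕ → ContDiffBump (0 : E) := fun n =>
    ⟨1 / (n + 2 : ℝ), 1 / (n + 1 : ℝ), by positivity, by
      apply one_div_lt_one_div_of_lt <;> [positivity; linarith]⟩
  have hρ : Tendsto (fun n => (ρ n).rOut) atTop (𝓝 0) := tendsto_one_div_add_atTop_nhds_zero_nat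
  have hvl : LocallyIntegrable v volume := hv.locallyIntegrable (by norm_num)
  have hdφ : Continuous fun x => fderiv ℝ φ x e :=
    (hφ.continuous_fderiv (by simp)).clm_apply continuous_const
  have hdφc : HasCompactSupport fun x => fderiv ℝ φ x e := hφc.fderiv_apply (𝕜 := ℝ) e
  have bdd : ∀ {ψ h : E → ℝ}, Continuous ψ → HasCompactSupport ψ → MemLp h 2 volume →
      MemLp (fun x => h x * ψ x) 2 volume := fun {ψ h} h1 h2 h3 =>
    (h1.memLp_top_of_hasCompactSupport h2 volume).mul h3
  have h1 := tendsto_integral_mul_normed_convolution (bdd hdφ hdφc hv) hv hρ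
  have h2 := tendsto_integral_mul_normed_convolution (bdd hφ.continuous hφc hv) hf hρ
  have h3 := tendsto_integral_mul_normed_convolution (bdd hφ.continuous hφc hf) hv hρ
  -- The weak derivative of `v` is tested against `φ V`, with `V` the mollified `v`; the limit is
  -- the product rule.
  have key : ∀ n, (∫ x, v x * fderiv ℝ φ x e *
        ((ρ n).normed volume ⋆[lsmul ℝ ℝ, volume] v) x) +
      (∫ x, v x * φ x * ((ρ n).normed volume ⋆[lsmul ℝ ℝ, volume] f) x) =
      - ∫ x, f x * φ x * ((ρ n).normed volume ⋆[lsmul ℝ ℝ, volume] v) x := fun n => by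
    set V := ((ρ n).normed volume ⋆[lsmul ℝ ℝ, volume] v) with hV
    set F := ((ρ n).normed volume ⋆[lsmul ℝ ℝ, volume] f) with hF
    have hVs : ContDiff ℝ ∞ V :=
      (ρ n).hasCompactSupport_normed.contDiff_convolution_left _ (ρ n).contDiff_normed hvl
    have hFs : ContDiff ℝ ∞ F :=
      (ρ n).hasCompactSupport_normed.contDiff_convolution_left _ (ρ n).contDiff_normed
        (hf.locallyIntegrable (by norm_num))
    have hVF : ∀ x, fderiv ℝ V x e = F x := fun x =>
      fderiv_convolution_eq_convolution (ρ n).contDiff_normed (ρ n).hasCompactSupport_normed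
        hvl hvf x
    have ht := hvf (fun x => φ x * V x) (hφ.mul hVs) hφc.mul_right
    have hder : ∀ x, fderiv ℝ (fun x => φ x * V x) x e = fderiv ℝ φ x e * V x + φ x * F x := by
      intro x
      rw [fderiv_fun_mul (hφ.differentiable (by simp) x) (hVs.differentiable (by simp) x)]
      simp only [add_apply, smul_apply, smul_eq_mul, hVF]
      ring
    have hi : ∀ {ψ : E → ℝ}, Continuous ψ → HasCompactSupport ψ →
        Integrable (fun x => v x * ψ x) volume := fun {ψ} a b => by
      simpa [mul_comm] using hvl.integrable_smul_left_of_hasCompactSupport a b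
    simp only [hder, mul_add] at ht
    rw [integral_add (hi (ψ := fun x => fderiv ℝ φ x e * V x) (hdφ.mul hVs.continuous) hdφc.mul_right)
      (hi (ψ := fun x => φ x * F x) (hφ.continuous.mul hFs.continuous) hφc.mul_right)] at ht
    simpa only [mul_assoc] using ht
  have := tendsto_nhds_unique ((h1.add h2).congr key) h3.neg
  have e1 : ∫ x, v x * fderiv ℝ φ x e * v x = ∫ x, v x ^ 2 * fderiv ℝ φ x e := by
    congr 1; ext x; ring
  have e2 : ∫ x, v x * φ x * f x = ∫ x, v x * f x * φ x := by
    congr 1; ext x; ring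
  have e3 : ∫ x, f x * φ x * v x = ∫ x, v x * f x * φ x := by
    congr 1; ext x; ring
  rw [e1, e2, e3] at this
  linarith

/-- Local version of `integral_sq_mul_fderiv_of_memLp`. -/
theorem integral_sq_mul_fderiv {v f : E → ℝ} {e : E}
    (hv : ∀ R : ℝ, MemLp v 2 (volume.restrict (Metric.closedBall 0 R)))
    (hf : ∀ R : ℝ, MemLp f 2 (volume.restrict (Metric.closedBall 0 R)))
    (hvl : LocallyIntegrable v volume) (hfl : LocallyIntegrable f volume)
    (hvf : ∀ φ : E → ℝ, ContDiff ℝ ∞ φ → HasCompactSupport φ →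
      ∫ x, v x * fderiv ℝ φ x e = - ∫ x, f x * φ x)
    {φ : E → ℝ} (hφ : ContDiff ℝ ∞ φ) (hφc : HasCompactSupport φ) :
    ∫ x, v x ^ 2 * fderiv ℝ φ x e = - (2 * ∫ x, v x * f x * φ x) := by
  obtain ⟨R, hR0, hR⟩ : ∃ R : ℝ, 0 < R ∧ tsupport φ ⊆ Metric.ball 0 R := by
    obtain ⟨R, hR⟩ := hφc.isCompact.isBounded.subset_ball 0
    exact ⟨max R 1, by positivity, hR.trans (Metric.ball_subset_ball (le_max_left _ _))⟩
  -- `η v` is globally in `L²` with weak derivative `η f + (∂η) v`. Since `η = 1` near the support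
  -- of `φ`, the cutoff leaves no trace in the final identity.
  let η : ContDiffBump (0 : E) := ⟨R, R + 1, hR0, by linarith⟩
  have hη : ContDiff ℝ ∞ η := η.contDiff
  have hηc : HasCompactSupport η := η.hasCompactSupport
  have hdη : Continuous fun x => fderiv ℝ η x e :=
    (hη.continuous_fderiv (by simp)).clm_apply continuous_const
  have hdηc : HasCompactSupport fun x => fderiv ℝ η x e := hηc.fderiv_apply (𝕜 := ℝ) e
  have cut : ∀ {ψ h : E → ℝ}, Continuous ψ → HasCompactSupport ψ →
      (∀ R : ℝ, MemLp h 2 (volume.restrict (Metric.closedBall 0 R))) →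
      MemLp (fun x => ψ x * h x) 2 volume := fun {ψ h} h1 h2 h3 => by
    obtain ⟨r, hr⟩ := h2.isCompact.isBounded.subset_closedBall 0
    have h4 : MemLp (fun x => ψ x * h x) 2 (volume.restrict (Metric.closedBall 0 r)) :=
      (h3 r).mul (p := ⊤) ((h1.memLp_top_of_hasCompactSupport h2 volume).restrict _)
    rw [← memLp_indicator_iff_restrict Metric.isClosed_closedBall.measurableSet] at h4
    convert h4 using 1
    refine (Set.indicator_eq_self.2 ?_).symm
    intro x hx
    exact hr (subset_tsupport _ (fun h0 => hx (by simp [h0])))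
  have hloc : ∀ {ψ h : E → ℝ}, LocallyIntegrable h volume → Continuous ψ →
      HasCompactSupport ψ → Integrable (fun x => h x * ψ x) volume := fun {ψ h} hl a b => by
    simpa [mul_comm] using hl.integrable_smul_left_of_hasCompactSupport a b
  have hV : MemLp (fun x => η x * v x) 2 volume := cut hη.continuous hηc hv
  have hF : MemLp (fun x => η x * f x + fderiv ℝ η x e * v x) 2 volume :=
    (cut hη.continuous hηc hf).add (cut hdη hdηc hv)
  have main := integral_sq_mul_fderiv_of_memLp hV hF (e := e) (fun ψ hψ hψc => by
    have ht := hvf (fun x => η x * ψ x) (hη.mul hψ) hψc.mul_left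
    have hder : ∀ x, fderiv ℝ (fun x => η x * ψ x) x e =
        η x * fderiv ℝ ψ x e + fderiv ℝ η x e * ψ x := by
      intro x
      rw [fderiv_fun_mul (hη.differentiable (by simp) x) (hψ.differentiable (by simp) x)]
      simp only [add_apply, smul_apply, smul_eq_mul]
      ring
    have hdψ : Continuous fun x => fderiv ℝ ψ x e :=
      (hψ.continuous_fderiv (by simp)).clm_apply continuous_const
    simp only [hder, mul_add] at ht
    rw [integral_add (hloc hvl (ψ := fun x => η x * fderiv ℝ ψ x e) (hη.continuous.mul hdψ) hηc.mul_right)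
      (hloc hvl (ψ := fun x => fderiv ℝ η x e * ψ x) (hdη.mul hψ.continuous)
        hψc.mul_left)] at ht
    have e1 : ∫ x, η x * v x * fderiv ℝ ψ x e = ∫ x, v x * (η x * fderiv ℝ ψ x e) := by
      congr 1; ext x; ring
    have e2 : ∫ x, (η x * f x + fderiv ℝ η x e * v x) * ψ x =
        (∫ x, f x * (η x * ψ x)) + ∫ x, v x * (fderiv ℝ η x e * ψ x) := by
      rw [← integral_add (hloc hfl (ψ := fun x => η x * ψ x) (hη.continuous.mul hψ.continuous)
        hψc.mul_left)
        (hloc hvl (ψ := fun x => fderiv ℝ η x e * ψ x) (hdη.mul hψ.continuous)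
        hψc.mul_left)]
      congr 1; ext x; ring
    rw [e1, e2]
    linarith) hφ hφc
  have hη1 : ∀ x ∈ tsupport φ, η x = 1 := fun x hx =>
    η.one_of_mem_closedBall (Metric.ball_subset_closedBall (hR hx))
  have hη2 : ∀ x ∈ tsupport φ, fderiv ℝ η x e = 0 := fun x hx => by
    have : (η : E → ℝ) =ᶠ[𝓝 x] fun _ => 1 := by
      filter_upwards [Metric.isOpen_ball.mem_nhds (hR hx)] with y hy
      exact η.one_of_mem_closedBall (Metric.ball_subset_closedBall hy)
    rw [this.fderiv_eq]; simp
  have e1 : ∫ x, (η x * v x) ^ 2 * fderiv ℝ φ x e = ∫ x, v x ^ 2 * fderiv ℝ φ x e := by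
    congr 1; ext x
    by_cases hx : x ∈ tsupport φ
    · rw [hη1 x hx, one_mul]
    · rw [fderiv_of_notMem_tsupport (𝕜 := ℝ) hx]; simp
  have e2 : ∫ x, η x * v x * (η x * f x + fderiv ℝ η x e * v x) * φ x =
      ∫ x, v x * f x * φ x := by
    congr 1; ext x
    by_cases hx : x ∈ tsupport φ
    · rw [hη1 x hx, hη2 x hx]; ring
    · rw [image_eq_zero_of_notMem_tsupport hx]; simp
  rw [e1, e2] at main
  exact main

end Mollification

/-! ### The scalar inequality behind the Hardy field -/

section RadialProfile

open Set Filter Topology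

/-- The smooth cutoff equal to `1` on `(-∞, t₀ / 2]` and to `0` on `[t₀, ∞)`. -/
noncomputable def smoothCutoff (t₀ t : ℝ) : ℝ := Real.smoothTransition (2 - 2 * t / t₀)

theorem contDiff_smoothCutoff (t₀ : ℝ) : ContDiff ℝ ∞ (smoothCutoff t₀) :=
  Real.smoothTransition.contDiff.comp
    (contDiff_const.sub ((contDiff_const.mul contDiff_id).div_const _))

theorem smoothCutoff_eq_one {t₀ t : ℝ} (h₀ : 0 < t₀) (h : t ≤ t₀ / 2) : smoothCutoff t₀ t = 1 := by
  apply Real.smoothTransition.one_of_one_le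
  have : 2 * t / t₀ ≤ 1 := by rw [div_le_one h₀]; linarith
  linarith

theorem smoothCutoff_eq_zero {t₀ t : ℝ} (h₀ : 0 < t₀) (h : t₀ ≤ t) : smoothCutoff t₀ t = 0 := by
  apply Real.smoothTransition.zero_of_nonpos
  have : 2 ≤ 2 * t / t₀ := by rw [le_div_iff₀ h₀]; linarith
  linarith

theorem contDiffOn_mul_smoothCutoff {f : ℝ → ℝ} (hf : ContDiffOn ℝ ∞ f (Ioi 0)) (t₀ : ℝ) :
    ContDiffOn ℝ ∞ (fun t => f t * smoothCutoff t₀ t) (Ioi 0) :=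
  hf.mul (contDiff_smoothCutoff t₀).contDiffOn

theorem deriv_mul_smoothCutoff_of_lt {f : ℝ → ℝ} {t₀ t : ℝ} (h₀ : 0 < t₀) (h : t < t₀ / 2) :
    deriv (fun t => f t * smoothCutoff t₀ t) t = deriv f t := by
  apply EventuallyEq.deriv_eq
  filter_upwards [Iio_mem_nhds h] with x hx
  rw [smoothCutoff_eq_one h₀ (le_of_lt hx), mul_one]

theorem deriv_mul_smoothCutoff_of_gt {f : ℝ → ℝ} {t₀ t : ℝ} (h₀ : 0 < t₀) (h : t₀ < t) :
    deriv (fun t => f t * smoothCutoff t₀ t) t = 0 := by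
  have : (fun t => f t * smoothCutoff t₀ t) =ᶠ[𝓝 t] fun _ => 0 := by
    filter_upwards [Ioi_mem_nhds h] with x hx
    rw [smoothCutoff_eq_zero h₀ (le_of_lt hx), mul_zero]
  rw [this.deriv_eq, deriv_const]

/-- A function that is smooth on `(0, ∞)` is bounded with its derivative on compact intervals. -/
theorem exists_bound_of_contDiffOn_Ioi {Q : ℝ → ℝ} (hQ : ContDiffOn ℝ ∞ Q (Ioi 0)) {a c : ℝ}
    (ha : 0 < a) : ∃ K : ℝ, 0 ≤ K ∧ ∀ t ∈ Icc a c, |Q t| ≤ K ∧ |deriv Q t| ≤ K := by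
  have hsub : Icc a c ⊆ Ioi 0 := fun t ht => lt_of_lt_of_le ha ht.1
  obtain ⟨K₁, h₁⟩ := isCompact_Icc.exists_bound_of_continuousOn (hQ.continuousOn.mono hsub)
  obtain ⟨K₂, h₂⟩ := isCompact_Icc.exists_bound_of_continuousOn
    ((hQ.continuousOn_deriv_of_isOpen isOpen_Ioi (by simp)).mono hsub)
  refine ⟨max 0 (max K₁ K₂), le_max_left _ _, fun t ht => ⟨(h₁ t ht).trans ?_, (h₂ t ht).trans ?_⟩⟩
  · exact (le_max_left _ _).trans (le_max_right _ _)
  · exact (le_max_right _ _).trans (le_max_right _ _)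

/-- The weight `e^{-b t^{m/2}}` as a function of `t = |x|²`. -/
noncomputable def sqWeight (b m t : ℝ) : ℝ := Real.exp (-b * t ^ (m / 2))

theorem sqWeight_pos (b m t : ℝ) : 0 < sqWeight b m t := Real.exp_pos _

theorem sqWeight_anti {b m : ℝ} (hm : 0 < m) (hb : 0 ≤ b) {s t : ℝ} (hs : 0 ≤ s) (hst : s ≤ t) :
    sqWeight b m t ≤ sqWeight b m s := by
  apply Real.exp_le_exp.2
  have := Real.rpow_le_rpow hs hst (half_pos hm).le
  nlinarith

theorem exp_neg_le_sqWeight {b m : ℝ} (hm : 0 < m) (hb : 0 ≤ b) {s : ℝ} (hs : 0 ≤ s)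
    (hs1 : s ≤ 1) : Real.exp (-b) ≤ sqWeight b m s := by
  simpa [sqWeight] using sqWeight_anti hm hb hs hs1

/-- Of the two smallness conditions, the first bounds `A t^m` by `t^{m/2}`, and the second makes the
derivative of `l (1/t + A t^{m-1})` nonpositive. -/
theorem exists_threshold {m A : ℝ} (hm : 0 < m) (hA : 0 < A) : ∃ t₀ : ℝ, 0 < t₀ ∧ t₀ ≤ 1 ∧
    ∀ t, 0 < t → t ≤ t₀ → A * t ^ (m / 2) ≤ 1 ∧ A * m * t ^ m ≤ 1 := by
  set δ := min 1 (min (1 / A) (1 / (A * m))) with hδ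
  have hAm : 0 < A * m := mul_pos hA hm
  have hδ0 : 0 < δ := by positivity
  have hδ1 : δ ≤ 1 := min_le_left _ _
  have hδA : δ ≤ 1 / A := (min_le_right _ _).trans (min_le_left _ _)
  have hδm : δ ≤ 1 / (A * m) := (min_le_right _ _).trans (min_le_right _ _)
  have ht1 : δ ^ (2 / m) ≤ 1 := Real.rpow_le_one hδ0.le hδ1 (by positivity)
  refine ⟨δ ^ (2 / m), Real.rpow_pos_of_pos hδ0 _, ht1, fun t ht htt => ?_⟩
  have h1 : t ^ (m / 2) ≤ δ := by
    have := Real.rpow_le_rpow ht.le htt (half_pos hm).le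
    rwa [← Real.rpow_mul hδ0.le, show 2 / m * (m / 2) = 1 by field_simp, Real.rpow_one] at this
  have h2 : t ^ m ≤ t ^ (m / 2) :=
    Real.rpow_le_rpow_of_exponent_ge ht (htt.trans ht1) (by linarith)
  constructor
  · calc A * t ^ (m / 2) ≤ A * (1 / A) := by gcongr; exact h1.trans hδA
      _ = 1 := by field_simp
  · calc A * m * t ^ m ≤ A * m * (1 / (A * m)) := by gcongr; exact h2.trans (h1.trans hδm)
      _ = 1 := by field_simp

/-- The pointwise inequality near the origin, with `P = 1 + A t^m`, `y = t^m`, `z = t^{m/2}`. -/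
theorem radial_profile_near_zero {l m b A s t y z Ws W : ℝ} (hl : 0 < l) (hm : 0 < m)
    (hb : 0 ≤ b) (hA : A = (b + 1) ^ 2 * l * Real.exp b / (2 * m)) (hst : s ≤ t)
    (ht : 0 < t) (hz : 0 ≤ z) (hy : y = z ^ 2) (hAz : A * z ≤ 1) (hAy : A * m * y ≤ 1)
    (hWs : W ≤ Ws) (hW : Real.exp (-b) ≤ W) (hW1 : W ≤ 1) (hWz : 1 - W ≤ b * z) :
    l ^ 2 * (W / t) ≤ (2 * l + 2) * (l * (1 + A * y) / t) +
      2 * s * (l * (-1 + A * (m - 1) * y) / t ^ 2) - s * (l * (1 + A * y) / t) ^ 2 / Ws := by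
  have hA0 : 0 < A := by rw [hA]; positivity
  have hW0 : 0 < W := (Real.exp_pos _).trans_le hW
  have hWs0 : 0 < Ws := hW0.trans_le hWs
  have hy0 : 0 ≤ y := by rw [hy]; positivity
  -- The derivative term is nonpositive, so replacing `s` by the larger `t` only lowers it. This
  -- reduces the claim to `s = t`.
  have h1 : 2 * t * (l * (-1 + A * (m - 1) * y) / t ^ 2) ≤
      2 * s * (l * (-1 + A * (m - 1) * y) / t ^ 2) := by
    apply mul_le_mul_of_nonpos_right (by linarith)
    apply div_nonpos_of_nonpos_of_nonneg _ (by positivity)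
    apply mul_nonpos_of_nonneg_of_nonpos hl.le
    nlinarith [mul_nonneg hA0.le hy0]
  have h2 : s * (l * (1 + A * y) / t) ^ 2 / Ws ≤ t * (l * (1 + A * y) / t) ^ 2 / W := by
    gcongr
  have h3 : (1 + A * y - W) ^ 2 ≤ (b + 1) ^ 2 * y := by
    have h4 : 0 ≤ 1 + A * y - W := by nlinarith [mul_nonneg hA0.le hy0]
    have h5 : 1 + A * y - W ≤ (b + 1) * z := by rw [hy]; nlinarith
    calc (1 + A * y - W) ^ 2 ≤ ((b + 1) * z) ^ 2 := by gcongr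
      _ = _ := by rw [hy]; ring
  -- `A` is chosen so that `l (b+1)² = 2 m A e^{-b}`, and `e^{-b} ≤ W`.
  have h6 : l * (1 + A * y - W) ^ 2 ≤ 2 * m * A * y * W := by
    calc l * (1 + A * y - W) ^ 2 ≤ l * ((b + 1) ^ 2 * y) := by gcongr
      _ = 2 * m * A * y * Real.exp (-b) := by
        rw [hA, Real.exp_neg]; field_simp
      _ ≤ _ := by gcongr
  -- With `P = 1 + A y`, right side minus left side is `(2 l m A y - l² (P - W)² / W) / t`: the gain
  -- from the correction against a perfect square.
  have h7 : l ^ 2 * (W / t) ≤ (2 * l + 2) * (l * (1 + A * y) / t) +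
      2 * t * (l * (-1 + A * (m - 1) * y) / t ^ 2) - t * (l * (1 + A * y) / t) ^ 2 / W := by
    rw [← sub_nonneg]
    have : (2 * l + 2) * (l * (1 + A * y) / t) +
      2 * t * (l * (-1 + A * (m - 1) * y) / t ^ 2) - t * (l * (1 + A * y) / t) ^ 2 / W -
      l ^ 2 * (W / t) = l * (2 * m * A * y * W - l * (1 + A * y - W) ^ 2) / (t * W) := by
      field_simp; ring
    rw [this]
    apply div_nonneg (mul_nonneg hl.le (by linarith)) (by positivity)
  linarith

/-- There is a radial profile `Q` whose field `Q(|x|² + ε) x` witnesses the weighted Hardy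
inequality. -/
theorem exists_radial_profile {l m b : ℝ} (hl : 0 < l) (hm : 0 < m) (hb : 0 ≤ b) :
    ∃ (Q : ℝ → ℝ) (C : ℝ), ContDiffOn ℝ ∞ Q (Ioi 0) ∧ (∀ t, 1 ≤ t → Q t = 0) ∧ 0 < C ∧
      ∀ s t, 0 ≤ s → s ≤ t → 0 < t →
        l ^ 2 * (sqWeight b m t / t) - C * sqWeight b m s ≤
          (2 * l + 2) * Q t + 2 * s * deriv Q t - s * Q t ^ 2 / sqWeight b m s := by
  set A := (b + 1) ^ 2 * l * Real.exp b / (2 * m) with hA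
  have hA0 : 0 < A := by positivity
  obtain ⟨t₀, ht₀, ht₀1, hsmall⟩ := exists_threshold hm hA0
  set f : ℝ → ℝ := fun t => l * (t⁻¹ + A * t ^ (m - 1)) with hf
  have hfs : ContDiffOn ℝ ∞ f (Ioi 0) := by
    refine contDiffOn_const.mul ((contDiffOn_inv ℝ).mono (fun t ht => (ne_of_gt ht)) |>.add
      (contDiffOn_const.mul ?_))
    exact contDiffOn_id.rpow_const_of_ne fun t ht => (ne_of_gt ht)
  set Q : ℝ → ℝ := fun t => f t * smoothCutoff t₀ t with hQ
  have hQs : ContDiffOn ℝ ∞ Q (Ioi 0) := contDiffOn_mul_smoothCutoff hfs t₀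
  obtain ⟨K, hK0, hK⟩ := exists_bound_of_contDiffOn_Ioi hQs (a := t₀ / 2) (c := t₀) (by positivity)
  -- The summands bound the four terms of the inequality on the transition zone `[t₀/2, t₀]`; the
  -- factor `e^b` pays for `W(s) ≥ e^{-b}`. The first summand also covers `t > t₀`, where `Q`
  -- vanishes.
  set C := Real.exp b * (l ^ 2 * (2 / t₀) + (2 * l + 2) * K + 2 * K + K ^ 2 * Real.exp b) with hC
  have hC0 : 0 < C := by positivity
  have hCl : l ^ 2 / t₀ ≤ C := by
    have h1 : 1 ≤ Real.exp b := Real.one_le_exp hb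
    have h2 : l ^ 2 / t₀ ≤ l ^ 2 * (2 / t₀) := by
      rw [mul_div_assoc']; gcongr; nlinarith [sq_nonneg l]
    have h3 : l ^ 2 * (2 / t₀) ≤
        l ^ 2 * (2 / t₀) + (2 * l + 2) * K + 2 * K + K ^ 2 * Real.exp b := by
      have : 0 ≤ (2 * l + 2) * K + 2 * K + K ^ 2 * Real.exp b := by positivity
      linarith
    exact (h2.trans h3).trans (le_mul_of_one_le_left (by positivity) h1)
  refine ⟨Q, C, hQs, fun t ht => ?_, hC0, fun s t hs hst ht => ?_⟩
  · simp only [hQ, smoothCutoff_eq_zero ht₀ (ht₀1.trans ht), mul_zero]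
  have hWs0 := sqWeight_pos b m s
  have hWst := sqWeight_anti hm hb hs hst
  have hW1 : sqWeight b m t ≤ 1 :=
    Real.exp_le_one_iff.2 (by nlinarith [Real.rpow_nonneg ht.le (m / 2)])
  rcases lt_or_ge t (t₀ / 2) with h | h
  · have hQt : Q t = l * (1 + A * t ^ m) / t := by
      simp only [hQ, hf, smoothCutoff_eq_one ht₀ h.le, Real.rpow_sub_one ht.ne']
      field_simp
    have hdQ : deriv Q t = l * (-1 + A * (m - 1) * t ^ m) / t ^ 2 := by
      rw [hQ, deriv_mul_smoothCutoff_of_lt ht₀ h]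
      have := ((hasDerivAt_inv ht.ne').add
        ((Real.hasDerivAt_rpow_const (p := m - 1) (Or.inl ht.ne')).const_mul A)).const_mul l
      rw [HasDerivAt.deriv (f := f) this, Real.rpow_sub_one ht.ne', Real.rpow_sub_one ht.ne']
      field_simp
    obtain ⟨hz, hy⟩ := hsmall t ht (h.le.trans (by linarith))
    have key := radial_profile_near_zero (y := t ^ m) (z := t ^ (m / 2)) hl hm hb hA hst ht
      (Real.rpow_nonneg ht.le _)
      (by rw [← Real.rpow_natCast, ← Real.rpow_mul ht.le]; congr 1; push_cast; ring) hz hy hWst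
      (exp_neg_le_sqWeight hm hb ht.le (by linarith)) hW1
      (by have := Real.add_one_le_exp (-b * t ^ (m / 2)); unfold sqWeight; linarith)
    rw [hQt, hdQ]
    have := mul_pos hC0 hWs0
    linarith
  rcases le_or_gt t t₀ with h' | h'
  · obtain ⟨hK1, hK2⟩ := hK t ⟨h, h'⟩
    have hs1 : s ≤ 1 := by linarith
    have hWb := exp_neg_le_sqWeight hm hb hs hs1
    have h1 : sqWeight b m t / t ≤ 2 / t₀ := by
      calc sqWeight b m t / t ≤ 1 / (t₀ / 2) := by gcongr
        _ = _ := by field_simp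
    have h2 : s * Q t ^ 2 / sqWeight b m s ≤ K ^ 2 * Real.exp b := by
      calc s * Q t ^ 2 / sqWeight b m s ≤ 1 * K ^ 2 / Real.exp (-b) := by
            gcongr ?_ * ?_ / ?_
            exact sq_le_sq' (abs_le.1 hK1).1 (abs_le.1 hK1).2
        _ = _ := by rw [Real.exp_neg]; field_simp
    have h3 : -((2 * l + 2) * K) ≤ (2 * l + 2) * Q t := by
      have := mul_le_mul_of_nonneg_left (abs_le.1 hK1).1 (by positivity : 0 ≤ 2 * l + 2)
      linarith
    have h4 : -(2 * K) ≤ 2 * s * deriv Q t := by nlinarith [(abs_le.1 hK2).1]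
    have h5 : l ^ 2 * (2 / t₀) + (2 * l + 2) * K + 2 * K + K ^ 2 * Real.exp b ≤
        C * sqWeight b m s := by
      calc _ = C * Real.exp (-b) := by rw [hC, Real.exp_neg]; field_simp
        _ ≤ _ := by gcongr
    have h6 := mul_le_mul_of_nonneg_left h1 (sq_nonneg l)
    linarith
  · have hQt : Q t = 0 := by simp only [hQ, smoothCutoff_eq_zero ht₀ h'.le, mul_zero]
    rw [hQt, hQ, deriv_mul_smoothCutoff_of_gt ht₀ h']
    have : l ^ 2 * (sqWeight b m t / t) ≤ C * sqWeight b m s := by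
      calc l ^ 2 * (sqWeight b m t / t) ≤ l ^ 2 * (sqWeight b m s / t₀) := by gcongr
        _ = l ^ 2 / t₀ * sqWeight b m s := by ring
        _ ≤ _ := by gcongr
    simp
    linarith

end RadialProfile

/-! ### Calculus of smooth functions of `|x|² + ε` -/

section RadialFunctions

open Set Filter Topology

theorem hasCompactSupport_comp_normSq_add {E : Type*} [NormedAddCommGroup E] [ProperSpace E]
    {F : ℝ → ℝ}
    (hF1 : ∀ t, 1 ≤ t → F t = 0) {ε : ℝ} (hε : 0 < ε) :
    HasCompactSupport fun x : E => F (‖x‖ ^ 2 + ε) := by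
  refine HasCompactSupport.intro (isCompact_closedBall (0 : E) 1) fun x hx => hF1 _ ?_
  simp only [Metric.mem_closedBall, dist_zero_right, not_le] at hx
  nlinarith

theorem continuous_deriv_comp_normSq_add {E : Type*} [NormedAddCommGroup E] {F : ℝ → ℝ}
    (hF : ContDiffOn ℝ ∞ F (Ioi 0)) {ε : ℝ}
    (hε : 0 < ε) : Continuous fun x : E => deriv F (‖x‖ ^ 2 + ε) :=
  (hF.continuousOn_deriv_of_isOpen isOpen_Ioi (by simp)).comp_continuous (by fun_prop)
    fun x => by change 0 < ‖x‖ ^ 2 + ε; positivity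

variable {E : Type*} [NormedAddCommGroup E] [InnerProductSpace ℝ E]

theorem contDiff_comp_normSq_add {F : ℝ → ℝ} (hF : ContDiffOn ℝ ∞ F (Ioi 0)) {ε : ℝ}
    (hε : 0 < ε) : ContDiff ℝ ∞ fun x : E => F (‖x‖ ^ 2 + ε) := by
  rw [← contDiffOn_univ]
  refine hF.comp ((contDiff_norm_sq ℝ).add contDiff_const).contDiffOn fun x _ => ?_
  change 0 < ‖x‖ ^ 2 + ε
  positivity

theorem fderiv_comp_normSq_add {F : ℝ → ℝ} (hF : ContDiffOn ℝ ∞ F (Ioi 0)) {ε : ℝ}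
    (hε : 0 < ε) (x v : E) : fderiv ℝ (fun x : E => F (‖x‖ ^ 2 + ε)) x v =
      2 * deriv F (‖x‖ ^ 2 + ε) * inner ℝ x v := by
  have hpos : 0 < ‖x‖ ^ 2 + ε := by positivity
  have hd : HasDerivAt F (deriv F (‖x‖ ^ 2 + ε)) (‖x‖ ^ 2 + ε) :=
    ((hF.differentiableOn (by simp)).differentiableAt (Ioi_mem_nhds hpos)).hasDerivAt
  have hn : HasFDerivAt (fun x : E => ‖x‖ ^ 2 + ε) (2 • innerSL ℝ x) x :=
    (hasStrictFDerivAt_norm_sq x).hasFDerivAt.add_const ε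
  rw [HasFDerivAt.fderiv (f := fun x : E => F (‖x‖ ^ 2 + ε)) (hd.comp_hasFDerivAt x hn)]
  simp
  ring

end RadialFunctions

/-! ### Fatou's lemma for Bochner integrals -/

section Fatou

open Filter Topology

/-- This removes `ε` in both halves: it produces the integrability of `u²/|x|²` in (i), and a false
integrability in (ii). -/
theorem integrable_and_integral_le_of_tendsto {α : Type*} [MeasurableSpace α] {μ : Measure α}
    {F : ℕ → α → ℝ} {f : α → ℝ} {M : ℝ} (hF : ∀ n, Integrable (F n) μ)
    (hF0 : ∀ n x, 0 ≤ F n x) (hM : ∀ n, ∫ x, F n x ∂μ ≤ M)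
    (hlim : ∀ᵐ x ∂μ, Tendsto (fun n => F n x) atTop (𝓝 (f x))) :
    Integrable f μ ∧ ∫ x, f x ∂μ ≤ M := by
  have hfm : AEStronglyMeasurable f μ :=
    aestronglyMeasurable_of_tendsto_ae atTop (fun n => (hF n).1) hlim
  have hf0 : 0 ≤ᵐ[μ] f := by
    filter_upwards [hlim] with x hx
    exact ge_of_tendsto' hx fun n => hF0 n x
  have hle : ∫⁻ x, ENNReal.ofReal (f x) ∂μ ≤ ENNReal.ofReal M := by
    calc ∫⁻ x, ENNReal.ofReal (f x) ∂μ
        = ∫⁻ x, liminf (fun n => ENNReal.ofReal (F n x)) atTop ∂μ := by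
          refine lintegral_congr_ae ?_
          filter_upwards [hlim] with x hx
          exact ((ENNReal.continuous_ofReal.tendsto _).comp hx).liminf_eq.symm
      _ ≤ liminf (fun n => ∫⁻ x, ENNReal.ofReal (F n x) ∂μ) atTop :=
          lintegral_liminf_le' fun n => (hF n).1.aemeasurable.ennreal_ofReal
      _ ≤ ENNReal.ofReal M := by
          refine liminf_le_of_le (by isBoundedDefault) fun c hc => ?_
          obtain ⟨n, hn⟩ := hc.exists
          refine hn.trans ?_
          rw [← ofReal_integral_eq_lintegral_ofReal (hF n) (Eventually.of_forall (hF0 n))]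
          exact ENNReal.ofReal_le_ofReal (hM n)
  have hfi : Integrable f μ := by
    refine ⟨hfm, ?_⟩
    rw [hasFiniteIntegral_iff_ofReal hf0]
    exact hle.trans_lt ENNReal.ofReal_lt_top
  refine ⟨hfi, ?_⟩
  have hM0 : 0 ≤ M := (integral_nonneg (hF0 0)).trans (hM 0)
  rw [← ENNReal.ofReal_le_ofReal_iff hM0, ofReal_integral_eq_lintegral_ofReal hfi hf0]
  exact hle

end Fatou

/-! ### The weighted measure compared with Lebesgue measure -/

section ExpPowerMeasure

open Set Filter Topology

variable {N : ℕ}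

theorem sqWeight_norm_sq (b m : ℝ) (x : EuclideanSpace ℝ (Fin N)) :
    sqWeight b m (‖x‖ ^ 2) = Real.exp (-b * ‖x‖ ^ m) := by
  unfold sqWeight
  rw [← Real.rpow_natCast, ← Real.rpow_mul (norm_nonneg x)]
  congr 3
  push_cast
  ring

theorem continuous_sqWeight {b m : ℝ} (hm : 0 < m) : Continuous (sqWeight b m) :=
  Real.continuous_exp.comp
    (continuous_const.mul (continuous_id.rpow_const fun _ => Or.inr (half_pos hm).le))

theorem tendsto_add_one_div_nat (a : ℝ) :
    Tendsto (fun n : ℕ => a + 1 / ((n : ℝ) + 1)) atTop (𝓝 a) := by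
  simpa only [add_zero] using
    tendsto_const_nhds.add (tendsto_one_div_add_atTop_nhds_zero_nat (𝕜 := ℝ))

theorem nontrivial_euclideanSpace (hN : 3 ≤ N) : Nontrivial (EuclideanSpace ℝ (Fin N)) := by
  have : Nonempty (Fin N) := ⟨⟨0, by omega⟩⟩
  infer_instance

theorem continuous_sqWeight_norm_sq {b m : ℝ} (hm : 0 < m) :
    Continuous fun x : EuclideanSpace ℝ (Fin N) => sqWeight b m (‖x‖ ^ 2) :=
  (continuous_sqWeight hm).comp (by fun_prop)

theorem expPowerMeasure_eq (N : ℕ) (b m : ℝ) : expPowerMeasure N b m =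
    volume.withDensity fun x => ENNReal.ofReal (sqWeight b m (‖x‖ ^ 2)) := by
  simp only [sqWeight_norm_sq]; rfl

theorem integrable_expPowerMeasure_iff {b m : ℝ} (hm : 0 < m)
    {f : EuclideanSpace ℝ (Fin N) → ℝ} : Integrable f (expPowerMeasure N b m) ↔
      Integrable (fun x => sqWeight b m (‖x‖ ^ 2) * f x) volume := by
  rw [expPowerMeasure_eq, integrable_withDensity_iff_integrable_smul'
    (continuous_sqWeight_norm_sq hm).measurable.ennreal_ofReal (by simp)]
  simp only [ENNReal.toReal_ofReal (sqWeight_pos _ _ _).le, smul_eq_mul]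

theorem integral_expPowerMeasure {b m : ℝ} (hm : 0 < m) (f : EuclideanSpace ℝ (Fin N) → ℝ) :
    ∫ x, f x ∂(expPowerMeasure N b m) = ∫ x, sqWeight b m (‖x‖ ^ 2) * f x := by
  rw [expPowerMeasure_eq, integral_withDensity_eq_integral_toReal_smul
    (continuous_sqWeight_norm_sq hm).measurable.ennreal_ofReal (by simp)]
  simp only [ENNReal.toReal_ofReal (sqWeight_pos _ _ _).le, smul_eq_mul]

theorem expPowerMeasure_le_volume {b : ℝ} (hb : 0 ≤ b) (m : ℝ) :
    expPowerMeasure N b m ≤ volume := by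
  conv_rhs => rw [← withDensity_one (μ := (volume : Measure (EuclideanSpace ℝ (Fin N))))]
  refine withDensity_mono (Eventually.of_forall fun x => ?_)
  simp only [Pi.one_apply, ENNReal.ofReal_le_one, Real.exp_le_one_iff]
  nlinarith [Real.rpow_nonneg (norm_nonneg x) m]

/-- On the ball the weight is at least its value at radius `R`, so Lebesgue measure there is at most
a constant times `μ`. -/
theorem memLp_restrict_closedBall {F : Type*} [NormedAddCommGroup F] {b m : ℝ} (hm : 0 < m)
    (hb : 0 ≤ b) {p : ENNReal} {f : EuclideanSpace ℝ (Fin N) → F}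
    (hf : MemLp f p (expPowerMeasure N b m)) (R : ℝ) :
    MemLp f p (volume.restrict (Metric.closedBall 0 R)) := by
  refine hf.of_measure_le_smul (c := ENNReal.ofReal (sqWeight b m (R ^ 2))⁻¹) (by simp) ?_
  have hmeas : Measurable fun x : EuclideanSpace ℝ (Fin N) =>
      ENNReal.ofReal (sqWeight b m (‖x‖ ^ 2)) :=
    (continuous_sqWeight_norm_sq hm).measurable.ennreal_ofReal
  rw [expPowerMeasure_eq, ← withDensity_smul _ hmeas,
    ← withDensity_indicator_one Metric.isClosed_closedBall.measurableSet]
  refine withDensity_mono (Eventually.of_forall fun x => ?_)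
  refine indicator_le' (fun y hy => ?_) (fun _ _ => zero_le) x
  have hy' : ‖y‖ ≤ R := by simpa using hy
  simp only [Pi.one_apply, Pi.smul_apply, smul_eq_mul]
  rw [← ENNReal.ofReal_mul (inv_nonneg.2 (sqWeight_pos _ _ _).le), ENNReal.one_le_ofReal,
    inv_mul_eq_div, one_le_div (sqWeight_pos _ _ _)]
  exact sqWeight_anti hm hb (sq_nonneg _) (by gcongr)

theorem integrable_mul_of_memLp_closedBall {u v : EuclideanSpace ℝ (Fin N) → ℝ}
    (hu : ∀ R : ℝ, MemLp u 2 (volume.restrict (Metric.closedBall 0 R)))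
    (hv : ∀ R : ℝ, MemLp v 2 (volume.restrict (Metric.closedBall 0 R)))
    {ψ : EuclideanSpace ℝ (Fin N) → ℝ} (hψ : Continuous ψ) (hψc : HasCompactSupport ψ) :
    Integrable (fun x => u x * v x * ψ x) volume := by
  have hl : LocallyIntegrable (fun x => u x * v x) volume := fun x => by
    refine ⟨Metric.closedBall 0 (‖x‖ + 1), ?_, (hu _).integrable_mul (hv _)⟩
    refine mem_of_superset (Metric.isOpen_ball.mem_nhds (x := x) ?_) Metric.ball_subset_closedBall
    simp
  simpa [mul_comm] using hl.integrable_smul_left_of_hasCompactSupport hψ hψc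

end ExpPowerMeasure

/-! ### The weighted Hardy inequality -/

section Hardy

open Set Filter Topology

variable {N : ℕ}

/-- The weak divergence theorem for `u²` tested against the radial field `Q(|x|² + ε) x`. -/
theorem radial_divergence_identity {u : EuclideanSpace ℝ (Fin N) → ℝ}
    {g : EuclideanSpace ℝ (Fin N) → EuclideanSpace ℝ (Fin N)} (hug : HasWeakGradient u g)
    (hu : ∀ R : ℝ, MemLp u 2 (volume.restrict (Metric.closedBall 0 R)))
    (hg : ∀ R : ℝ, MemLp g 2 (volume.restrict (Metric.closedBall 0 R)))
    {Q : ℝ → ℝ} (hQ : ContDiffOn ℝ ∞ Q (Ioi 0)) (hQ1 : ∀ t, 1 ≤ t → Q t = 0) {ε : ℝ}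
    (hε : 0 < ε) :
    Integrable (fun x => u x ^ 2 * (N * Q (‖x‖ ^ 2 + ε) +
        2 * ‖x‖ ^ 2 * deriv Q (‖x‖ ^ 2 + ε)) +
      2 * (u x * (Q (‖x‖ ^ 2 + ε) * inner ℝ x (g x)))) volume ∧
    ∫ x, (u x ^ 2 * (N * Q (‖x‖ ^ 2 + ε) + 2 * ‖x‖ ^ 2 * deriv Q (‖x‖ ^ 2 + ε)) +
      2 * (u x * (Q (‖x‖ ^ 2 + ε) * inner ℝ x (g x)))) = 0 := by
  -- These are the components of the field; applying the product rule to each and summing over `i`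
  -- produces the divergence.
  let φ : Fin N → EuclideanSpace ℝ (Fin N) → ℝ := fun i x => Q (‖x‖ ^ 2 + ε) * x i
  have hcoord : ∀ i, ContDiff ℝ ∞ fun x : EuclideanSpace ℝ (Fin N) => x i := fun i => by fun_prop
  have hφ : ∀ i, ContDiff ℝ ∞ (φ i) := fun i => (contDiff_comp_normSq_add hQ hε).mul (hcoord i)
  have hφc : ∀ i, HasCompactSupport (φ i) := fun i =>
    (hasCompactSupport_comp_normSq_add hQ1 hε).mul_right
  have hdφ : ∀ i x, fderiv ℝ (φ i) x (EuclideanSpace.single i 1) =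
      Q (‖x‖ ^ 2 + ε) + 2 * x i ^ 2 * deriv Q (‖x‖ ^ 2 + ε) := fun i x => by
    have h1 := (contDiff_comp_normSq_add (E := EuclideanSpace ℝ (Fin N)) hQ hε).differentiable
      (by simp) x
    have h2 : HasFDerivAt (fun x : EuclideanSpace ℝ (Fin N) => x i)
      (EuclideanSpace.proj i : EuclideanSpace ℝ (Fin N) →L[ℝ] ℝ) x :=
      (EuclideanSpace.proj i : EuclideanSpace ℝ (Fin N) →L[ℝ] ℝ).hasFDerivAt
    rw [show φ i = fun x => Q (‖x‖ ^ 2 + ε) * x i from rfl, fderiv_fun_mul h1 h2.differentiableAt,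
      h2.fderiv]
    simp only [add_apply, smul_apply, smul_eq_mul, fderiv_comp_normSq_add hQ hε]
    simp [EuclideanSpace.inner_single_right]
    ring
  have hgi : ∀ i R, MemLp (fun x => g x i) 2 (volume.restrict (Metric.closedBall 0 R)) :=
    fun i R => (EuclideanSpace.proj (𝕜 := ℝ) i).comp_memLp' (hg R)
  have hgl : ∀ i, LocallyIntegrable (fun x => g x i) volume := fun i x => by
    obtain ⟨s, hs, hgs⟩ := hug.locallyIntegrable_grad x
    exact ⟨s, hs, (EuclideanSpace.proj (𝕜 := ℝ) i).integrable_comp hgs⟩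
  have hd : ∀ i, Continuous fun x => fderiv ℝ (φ i) x (EuclideanSpace.single i 1) := fun i =>
    ((hφ i).continuous_fderiv (by simp)).clm_apply continuous_const
  have hi1 : ∀ i, Integrable
      (fun x => u x ^ 2 * fderiv ℝ (φ i) x (EuclideanSpace.single i 1)) volume := fun i => by
    simpa only [sq] using integrable_mul_of_memLp_closedBall hu hu (hd i)
      ((hφc i).fderiv_apply (𝕜 := ℝ) _)
  have hi2 : ∀ i, Integrable (fun x => u x * g x i * φ i x) volume := fun i =>
    integrable_mul_of_memLp_closedBall hu (hgi i) (hφ i).continuous (hφc i)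
  have hid : ∀ i, ∫ x, (u x ^ 2 * fderiv ℝ (φ i) x (EuclideanSpace.single i 1) +
      2 * (u x * g x i * φ i x)) = 0 := fun i => by
    rw [integral_add (hi1 i) ((hi2 i).const_mul 2), integral_const_mul,
      integral_sq_mul_fderiv hu (hgi i) hug.locallyIntegrable (hgl i)
        (fun ψ h1 h2 => hug.integral_eq ψ h1 h2 i) (hφ i) (hφc i)]
    ring
  have hsum : ∀ x, u x ^ 2 * (N * Q (‖x‖ ^ 2 + ε) + 2 * ‖x‖ ^ 2 * deriv Q (‖x‖ ^ 2 + ε)) +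
      2 * (u x * (Q (‖x‖ ^ 2 + ε) * inner ℝ x (g x))) =
      ∑ i, (u x ^ 2 * fderiv ℝ (φ i) x (EuclideanSpace.single i 1) +
        2 * (u x * g x i * φ i x)) := fun x => by
    simp only [hdφ, φ]
    have h1 : inner ℝ x (g x) = ∑ i, g x i * x i := by simp [PiLp.inner_apply]
    have h2 : ‖x‖ ^ 2 = ∑ i, x i ^ 2 := EuclideanSpace.real_norm_sq_eq x
    generalize Q (‖x‖ ^ 2 + ε) = q
    generalize deriv Q (‖x‖ ^ 2 + ε) = q'
    rw [h1, h2]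
    simp only [mul_add, Finset.sum_add_distrib, Finset.mul_sum, Finset.sum_mul, Finset.sum_const,
      Finset.card_univ, Fintype.card_fin, nsmul_eq_mul]
    congr 1
    · congr 1; ring
    · exact Finset.sum_congr rfl fun i _ => by ring
  simp only [hsum]
  have hint : ∀ i ∈ Finset.univ, Integrable (fun x =>
      u x ^ 2 * fderiv ℝ (φ i) x (EuclideanSpace.single i 1) + 2 * (u x * g x i * φ i x))
      volume := fun i _ => (hi1 i).add ((hi2 i).const_mul 2)
  refine ⟨integrable_finsetSum _ hint, ?_⟩
  rw [integral_finsetSum _ hint]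
  exact Finset.sum_eq_zero fun i _ => hid i

/-- Expand `‖W y + v q x‖² ≥ 0` and divide by `W`. -/
theorem neg_sq_mul_le {E : Type*} [NormedAddCommGroup E] [InnerProductSpace ℝ E] (x y : E)
    {W : ℝ} (hW : 0 < W) (v q : ℝ) :
    -(v ^ 2 * (‖x‖ ^ 2 * q ^ 2 / W)) ≤ W * ‖y‖ ^ 2 + 2 * (v * (q * inner ℝ x y)) := by
  have h := sq_nonneg ‖W • y + (v * q) • x‖
  rw [norm_add_sq_real, inner_smul_left, inner_smul_right, norm_smul, norm_smul,
    real_inner_comm] at h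
  simp only [mul_pow, Real.norm_eq_abs, sq_abs, conj_trivial] at h
  have h2 : 0 ≤ (W ^ 2 * ‖y‖ ^ 2 + 2 * (W * (v * q * inner ℝ x y)) +
      v ^ 2 * q ^ 2 * ‖x‖ ^ 2) / W := div_nonneg h hW.le
  have h3 : (W ^ 2 * ‖y‖ ^ 2 + 2 * (W * (v * q * inner ℝ x y)) + v ^ 2 * q ^ 2 * ‖x‖ ^ 2) / W =
      W * ‖y‖ ^ 2 + 2 * (v * (q * inner ℝ x y)) + v ^ 2 * (‖x‖ ^ 2 * q ^ 2 / W) := by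
    field_simp
  linarith

/-- The weighted Hardy inequality. -/
theorem exists_hardy_expPowerMeasure (hN : 3 ≤ N) {m b : ℝ} (hm : 0 < m) (hb : 0 ≤ b) :
    ∃ C : ℝ, 0 < C ∧ ∀ (u : EuclideanSpace ℝ (Fin N) → ℝ)
        (g : EuclideanSpace ℝ (Fin N) → EuclideanSpace ℝ (Fin N)),
        MemH1WithGradient (expPowerMeasure N b m) u g →
          Integrable (fun x => u x ^ 2 / ‖x‖ ^ 2) (expPowerMeasure N b m) ∧
          hardyConst N * ∫ x, u x ^ 2 / ‖x‖ ^ 2 ∂(expPowerMeasure N b m) ≤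
            ∫ x, ‖g x‖ ^ 2 ∂(expPowerMeasure N b m) +
              C * ∫ x, u x ^ 2 ∂(expPowerMeasure N b m) := by
  set l : ℝ := ((N : ℝ) - 2) / 2 with hl
  have hl0 : 0 < l := by
    have : (3 : ℝ) ≤ N := by exact_mod_cast hN
    rw [hl]; linarith
  have hNl : 2 * l + 2 = N := by rw [hl]; ring
  obtain ⟨Q, C, hQ, hQ1, hC, hineq⟩ := exists_radial_profile hl0 hm hb
  rw [hNl] at hineq
  refine ⟨C, hC, fun u g hug => ?_⟩
  have hu2 : Integrable (fun x => sqWeight b m (‖x‖ ^ 2) * u x ^ 2) volume :=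
    (integrable_expPowerMeasure_iff hm).1 hug.memLp.integrable_sq
  have hg2 : Integrable (fun x => sqWeight b m (‖x‖ ^ 2) * ‖g x‖ ^ 2) volume :=
    (integrable_expPowerMeasure_iff hm).1 (hug.memLp_grad.integrable_norm_pow (by simp))
  have hdiv : ∀ ε : ℝ, 0 < ε → _ := fun ε hε => radial_divergence_identity hug.hasWeakGradient
    (memLp_restrict_closedBall hm hb hug.memLp) (memLp_restrict_closedBall hm hb hug.memLp_grad)
    hQ hQ1 hε
  set M : ℝ := (∫ x, sqWeight b m (‖x‖ ^ 2) * ‖g x‖ ^ 2) +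
    C * ∫ x, sqWeight b m (‖x‖ ^ 2) * u x ^ 2 with hM
  let ε : ℕ → ℝ := fun n => 1 / ((n : ℝ) + 1)
  have hε : ∀ n, 0 < ε n := fun n => by positivity
  let F : ℕ → EuclideanSpace ℝ (Fin N) → ℝ := fun n x =>
    u x ^ 2 * (l ^ 2 * (sqWeight b m (‖x‖ ^ 2 + ε n) / (‖x‖ ^ 2 + ε n)))
  have hF0 : ∀ n x, 0 ≤ F n x := fun n x => by
    have h1 := hε n
    have h2 := sqWeight_pos b m (‖x‖ ^ 2 + ε n)
    positivity
  -- The last summand is the divergence expression, whose integral is zero; adding it makes the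
  -- bound hold pointwise.
  have hFle : ∀ n x, F n x ≤ (sqWeight b m (‖x‖ ^ 2) * ‖g x‖ ^ 2 +
      C * (sqWeight b m (‖x‖ ^ 2) * u x ^ 2)) +
      (u x ^ 2 * (N * Q (‖x‖ ^ 2 + ε n) + 2 * ‖x‖ ^ 2 * deriv Q (‖x‖ ^ 2 + ε n)) +
        2 * (u x * (Q (‖x‖ ^ 2 + ε n) * inner ℝ x (g x)))) := fun n x => by
    have h1 := hε n
    have h2 := mul_le_mul_of_nonneg_left (hineq (‖x‖ ^ 2) (‖x‖ ^ 2 + ε n) (by positivity)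
      (by linarith) (by positivity)) (sq_nonneg (u x))
    have h3 := neg_sq_mul_le x (g x) (sqWeight_pos b m (‖x‖ ^ 2)) (u x) (Q (‖x‖ ^ 2 + ε n))
    simp only [F]
    linarith
  have hGi : ∀ n, Integrable (fun x => (sqWeight b m (‖x‖ ^ 2) * ‖g x‖ ^ 2 +
      C * (sqWeight b m (‖x‖ ^ 2) * u x ^ 2)) +
      (u x ^ 2 * (N * Q (‖x‖ ^ 2 + ε n) + 2 * ‖x‖ ^ 2 * deriv Q (‖x‖ ^ 2 + ε n)) +
        2 * (u x * (Q (‖x‖ ^ 2 + ε n) * inner ℝ x (g x))))) volume := fun n =>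
    (hg2.add (hu2.const_mul C)).add (hdiv _ (hε n)).1
  have hWc : Continuous (sqWeight b m) := continuous_sqWeight hm
  have hFi : ∀ n, Integrable (F n) volume := fun n => by
    refine (hGi n).mono' ?_ (Eventually.of_forall fun x => ?_)
    · refine (hug.hasWeakGradient.locallyIntegrable.aestronglyMeasurable.pow 2).mul
        (Continuous.aestronglyMeasurable (continuous_const.mul (Continuous.div
          (hWc.comp (by fun_prop)) (by fun_prop) fun x => ?_)))
      have := hε n
      positivity
    · rw [Real.norm_of_nonneg (hF0 n x)]
      exact hFle n x
  have hFM : ∀ n, ∫ x, F n x ≤ M := fun n => by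
    refine (integral_mono (hFi n) (hGi n) (hFle n)).trans_eq ?_
    rw [integral_add (f := fun x => _ + _) (hg2.add (hu2.const_mul C)) (hdiv _ (hε n)).1, (hdiv _ (hε n)).2, add_zero,
      integral_add hg2 (hu2.const_mul C), integral_const_mul]
  have hlim : ∀ᵐ x : EuclideanSpace ℝ (Fin N), Tendsto (fun n => F n x) atTop
      (𝓝 (l ^ 2 * (sqWeight b m (‖x‖ ^ 2) * (u x ^ 2 / ‖x‖ ^ 2)))) := by
    have := nontrivial_euclideanSpace hN
    filter_upwards [Measure.ae_ne volume (0 : EuclideanSpace ℝ (Fin N))] with x hx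
    have hx2 : ‖x‖ ^ 2 ≠ 0 := by simpa using hx
    have h1 : Tendsto (fun n => ‖x‖ ^ 2 + ε n) atTop (𝓝 (‖x‖ ^ 2)) := tendsto_add_one_div_nat _
    have h2 := ((((hWc.tendsto _).comp h1).div h1 hx2).const_mul (l ^ 2)).const_mul (u x ^ 2)
    rw [show l ^ 2 * (sqWeight b m (‖x‖ ^ 2) * (u x ^ 2 / ‖x‖ ^ 2)) =
      u x ^ 2 * (l ^ 2 * (sqWeight b m (‖x‖ ^ 2) / ‖x‖ ^ 2)) by ring]
    exact h2
  obtain ⟨h1, h2⟩ := integrable_and_integral_le_of_tendsto hFi hF0 hFM hlim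
  have hl2 : l ^ 2 ≠ 0 := by positivity
  refine ⟨(integrable_expPowerMeasure_iff hm).2 ?_, ?_⟩
  · exact (integrable_const_mul_iff (IsUnit.mk0 _ hl2) _).1 h1
  · simp only [integral_expPowerMeasure hm]
    rw [integral_const_mul] at h2
    exact h2

end Hardy

/-! ### Optimality of the constant -/

section Optimality

open Set Filter Topology

variable {N : ℕ}

theorem hasWeakGradient_radial {P : ℝ → ℝ} (hP : ContDiffOn ℝ ∞ P (Ioi 0)) {ε : ℝ} (hε : 0 < ε) :
    HasWeakGradient (fun x : EuclideanSpace ℝ (Fin N) => P (‖x‖ ^ 2 + ε))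
      (fun x => (2 * deriv P (‖x‖ ^ 2 + ε)) • x) := by
  have hu : ContDiff ℝ ∞ fun x : EuclideanSpace ℝ (Fin N) => P (‖x‖ ^ 2 + ε) :=
    contDiff_comp_normSq_add hP hε
  have hg : Continuous fun x : EuclideanSpace ℝ (Fin N) => (2 * deriv P (‖x‖ ^ 2 + ε)) • x :=
    (continuous_const.mul (continuous_deriv_comp_normSq_add hP hε)).smul continuous_id
  refine ⟨hu.continuous.locallyIntegrable, hg.locallyIntegrable, fun φ hφ hφc i => ?_⟩
  have hcomp : ∀ x : EuclideanSpace ℝ (Fin N), ((2 * deriv P (‖x‖ ^ 2 + ε)) • x) i =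
      fderiv ℝ (fun x : EuclideanSpace ℝ (Fin N) => P (‖x‖ ^ 2 + ε)) x
        (EuclideanSpace.single i 1) := fun x => by
    rw [fderiv_comp_normSq_add hP hε]
    simp [EuclideanSpace.inner_single_right]
  simp only [hcomp]
  have hdu : Continuous fun x => fderiv ℝ (fun x : EuclideanSpace ℝ (Fin N) => P (‖x‖ ^ 2 + ε)) x
      (EuclideanSpace.single i 1) :=
    (hu.continuous_fderiv (by simp)).clm_apply continuous_const
  have hdφ : Continuous fun x => fderiv ℝ φ x (EuclideanSpace.single i 1) :=
    (hφ.continuous_fderiv (by simp)).clm_apply continuous_const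
  exact integral_mul_fderiv_eq_neg_fderiv_mul_of_integrable
    ((hdu.mul hφ.continuous).integrable_of_hasCompactSupport hφc.mul_left)
    ((hu.continuous.mul hdφ).integrable_of_hasCompactSupport
      (hφc.fderiv_apply (𝕜 := ℝ) _).mul_left)
    ((hu.continuous.mul hφ.continuous).integrable_of_hasCompactSupport hφc.mul_left)
    (fun x _ => hu.differentiable (by simp) x) (fun x _ => hφ.differentiable (by simp) x)

theorem deriv_eq_zero_of_forall_ge {P : ℝ → ℝ} (hP : ContDiffOn ℝ ∞ P (Ioi 0))
    (hP1 : ∀ t, 1 ≤ t → P t = 0) (t : ℝ) (ht : 1 ≤ t) : deriv P t = 0 := by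
  have hd : DifferentiableAt ℝ P t :=
    (hP.differentiableOn (by simp)).differentiableAt (Ioi_mem_nhds (by linarith))
  -- At `t = 1` the function is known to vanish only on one side, so the derivative is computed
  -- within `[1, ∞)`.
  have h := uniqueDiffOn_Ici (1 : ℝ) t ht
  have h0 : EqOn P (fun _ => 0) (Ici 1) := fun s hs => hP1 s hs
  rw [← hd.derivWithin h, derivWithin_congr h0 (hP1 t ht)]
  simp

theorem memH1WithGradient_radial {b : ℝ} (hb : 0 ≤ b) (m : ℝ) {P : ℝ → ℝ}
    (hP : ContDiffOn ℝ ∞ P (Ioi 0)) (hP1 : ∀ t, 1 ≤ t → P t = 0) {ε : ℝ} (hε : 0 < ε) :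
    MemH1WithGradient (expPowerMeasure N b m)
      (fun x : EuclideanSpace ℝ (Fin N) => P (‖x‖ ^ 2 + ε))
      (fun x => (2 * deriv P (‖x‖ ^ 2 + ε)) • x) := by
  refine ⟨hasWeakGradient_radial hP hε, ?_, ?_⟩
  · exact ((contDiff_comp_normSq_add hP hε).continuous.memLp_of_hasCompactSupport
      (hasCompactSupport_comp_normSq_add hP1 hε)).mono_measure (expPowerMeasure_le_volume hb m)
  · refine (Continuous.memLp_of_hasCompactSupport (μ := volume) ((continuous_const.mul
      (continuous_deriv_comp_normSq_add hP hε)).smul continuous_id) ?_).mono_measure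
      (expPowerMeasure_le_volume hb m)
    exact (hasCompactSupport_comp_normSq_add (deriv_eq_zero_of_forall_ge hP hP1) hε).mul_left
      |>.smul_right

/-- A cut-off power `t^{-l/2}`, almost optimal for the Hardy inequality. -/
theorem exists_almost_optimal_profile {l : ℝ} (hl : 0 < l) {δ : ℝ} (hδ : 0 < δ) (C : ℝ) :
    ∃ (P : ℝ → ℝ) (M r : ℝ), ContDiffOn ℝ ∞ P (Ioi 0) ∧ (∀ t, 1 ≤ t → P t = 0) ∧ 0 ≤ M ∧
      0 < r ∧ r ≤ 1 ∧ (∀ t, 0 < t → t < r → P t ^ 2 = t ^ (-l)) ∧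
      ∀ s t, 0 < s → s ≤ t → 4 * s * deriv P t ^ 2 + C * P t ^ 2 ≤
        (l ^ 2 + δ) * (P t ^ 2 / s) + if s ≤ 1 then M else 0 := by
  -- This gives `|C| s ≤ δ` for `s ≤ t₀`, so `C P²` is absorbed by `δ P²/s`.
  set t₀ := min 1 (δ / (|C| + 1)) with ht
  have ht₀ : 0 < t₀ := by positivity
  have ht₀1 : t₀ ≤ 1 := min_le_left _ _
  have ht₀C : |C| * t₀ ≤ δ := by
    have h1 : t₀ * (|C| + 1) ≤ δ := (le_div_iff₀ (by positivity)).1 (min_le_right _ _)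
    linarith
  set f : ℝ → ℝ := fun t => t ^ (-(l / 2)) with hf
  have hfs : ContDiffOn ℝ ∞ f (Ioi 0) := contDiffOn_id.rpow_const_of_ne fun t ht => (ne_of_gt ht)
  set P : ℝ → ℝ := fun t => f t * smoothCutoff t₀ t with hP
  have hPs : ContDiffOn ℝ ∞ P (Ioi 0) := contDiffOn_mul_smoothCutoff hfs t₀
  obtain ⟨K, hK0, hK⟩ := exists_bound_of_contDiffOn_Ioi hPs (a := t₀ / 2) (c := t₀) (by positivity)
  have hPf : ∀ t, t < t₀ / 2 → P t = f t := fun t h => by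
    simp only [hP, smoothCutoff_eq_one ht₀ h.le, mul_one]
  -- The constant `M` bounds the left side on the transition zone. Charging it only for `s ≤ 1`
  -- keeps the error on a set of finite measure, even when `b = 0`.
  refine ⟨P, 4 * K ^ 2 + |C| * K ^ 2, t₀ / 2, hPs, fun t ht => ?_, by positivity, by positivity,
    by linarith, fun t ht0 htr => ?_, fun s t hs hst => ?_⟩
  · simp only [hP, smoothCutoff_eq_zero ht₀ (ht₀1.trans ht), mul_zero]
  · rw [hPf t htr, hf, ← Real.rpow_natCast, ← Real.rpow_mul ht0.le]
    congr 1; push_cast; ring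
  have ht0 : 0 < t := hs.trans_le hst
  have hif : (0 : ℝ) ≤ if s ≤ 1 then 4 * K ^ 2 + |C| * K ^ 2 else 0 := by positivity
  have hq : 0 ≤ (l ^ 2 + δ) * (P t ^ 2 / s) := by positivity
  rcases lt_or_ge t (t₀ / 2) with h | h
  · have hdP : deriv P t = -(l / 2) * (P t / t) := by
      rw [hPf t h, hP, deriv_mul_smoothCutoff_of_lt ht₀ h, hf]
      rw [(Real.hasDerivAt_rpow_const (p := -(l / 2)) (Or.inl ht0.ne')).deriv,
        Real.rpow_sub_one ht0.ne']
    -- The exponent `-l/2` gives `P' = -(l/2) P/t`, and `s/t² ≤ 1/s`.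
    have h1 : 4 * s * deriv P t ^ 2 ≤ l ^ 2 * (P t ^ 2 / s) := by
      calc 4 * s * deriv P t ^ 2 = l ^ 2 * P t ^ 2 * (s / t ^ 2) := by rw [hdP]; field_simp; ring
        _ ≤ l ^ 2 * P t ^ 2 * (1 / s) := by
            refine mul_le_mul_of_nonneg_left ?_ (by positivity)
            rw [div_le_div_iff₀ (by positivity) hs]
            nlinarith
        _ = _ := by ring
    have h2 : C * P t ^ 2 ≤ δ * (P t ^ 2 / s) := by
      have : C ≤ δ / s := by
        rw [le_div_iff₀ hs]
        calc C * s ≤ |C| * t₀ := by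
              apply mul_le_mul (le_abs_self C) (by linarith) hs.le (abs_nonneg C)
          _ ≤ δ := ht₀C
      calc C * P t ^ 2 ≤ δ / s * P t ^ 2 := by gcongr
        _ = _ := by ring
    linarith
  rcases le_or_gt t t₀ with h' | h'
  · obtain ⟨hK1, hK2⟩ := hK t ⟨h, h'⟩
    rw [if_pos (by linarith)]
    have h1 : P t ^ 2 ≤ K ^ 2 := sq_le_sq' (abs_le.1 hK1).1 (abs_le.1 hK1).2
    have h2 : deriv P t ^ 2 ≤ K ^ 2 := sq_le_sq' (abs_le.1 hK2).1 (abs_le.1 hK2).2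
    have h3 : 4 * s * deriv P t ^ 2 ≤ 4 * K ^ 2 := by
      calc 4 * s * deriv P t ^ 2 ≤ 4 * 1 * K ^ 2 := by gcongr; linarith
        _ = _ := by ring
    have h4 : C * P t ^ 2 ≤ |C| * K ^ 2 := by
      calc C * P t ^ 2 ≤ |C| * P t ^ 2 := by gcongr; exact le_abs_self C
        _ ≤ _ := by gcongr
    linarith
  · have hPt : P t = 0 := by simp only [hP, smoothCutoff_eq_zero ht₀ h'.le, mul_zero]
    have hdP : deriv P t = 0 := by rw [hP, deriv_mul_smoothCutoff_of_gt ht₀ h']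
    rw [hPt] at hq
    rw [hPt, hdP]
    linarith

/-- In polar coordinates the integrand becomes `y^{N-1} y^{-N} = y^{-1}`. -/
theorem not_integrableOn_norm_rpow_neg (hN : 3 ≤ N) {r : ℝ} (hr : 0 < r) :
    ¬ IntegrableOn (fun x : EuclideanSpace ℝ (Fin N) => ‖x‖ ^ (-(N : ℝ))) (Metric.ball 0 r)
      volume := by
  have := nontrivial_euclideanSpace hN
  rw [integrableOn_fun_norm_addHaar volume (f := fun y => y ^ (-(N : ℝ)))]
  intro h
  have h2 : IntegrableOn (fun y : ℝ => y ^ (-1 : ℝ)) (Ioo 0 r) := by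
    refine h.congr_fun (fun y hy => ?_) measurableSet_Ioo
    have hy0 : 0 < y := hy.1
    simp only [finrank_euclideanSpace, Fintype.card_fin, smul_eq_mul]
    rw [← Real.rpow_natCast, ← Real.rpow_add hy0]
    congr 1
    rw [Nat.cast_sub (by omega)]
    push_cast; ring
  rw [intervalIntegral.integrableOn_Ioo_rpow_iff hr] at h2
  exact lt_irrefl _ h2

/-- The Hardy constant is optimal. -/
theorem exists_hardy_violation (hN : 3 ≤ N) {m b : ℝ} (hm : 0 < m) (hb : 0 ≤ b) {c : ℝ}
    (hc : hardyConst N < c) (C : ℝ) :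
    ∃ (u : EuclideanSpace ℝ (Fin N) → ℝ)
        (g : EuclideanSpace ℝ (Fin N) → EuclideanSpace ℝ (Fin N)),
        MemH1WithGradient (expPowerMeasure N b m) u g ∧
          Integrable (fun x => u x ^ 2 / ‖x‖ ^ 2) (expPowerMeasure N b m) ∧
          ∫ x, ‖g x‖ ^ 2 ∂(expPowerMeasure N b m) +
              C * ∫ x, u x ^ 2 ∂(expPowerMeasure N b m) <
            c * ∫ x, u x ^ 2 / ‖x‖ ^ 2 ∂(expPowerMeasure N b m) := by
  have := nontrivial_euclideanSpace hN
  set l : ℝ := ((N : ℝ) - 2) / 2 with hl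
  have hl0 : 0 < l := by
    have : (3 : ℝ) ≤ N := by exact_mod_cast hN
    rw [hl]; linarith
  -- Half the gap: `c = l² + 2δ`, so one `δ` is spent on the profile estimate and the other bounds
  -- `∫ u²/|x|² dμ`.
  set δ : ℝ := (c - l ^ 2) / 2 with hδ
  have hδ0 : 0 < δ := by
    have : l ^ 2 < c := hc
    rw [hδ]; linarith
  obtain ⟨P, M, r, hP, hP1, hM, hr, hr1, hPr, hineq⟩ := exists_almost_optimal_profile hl0 hδ0 C
  obtain ⟨C', -, hardy⟩ := exists_hardy_expPowerMeasure hN hm hb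
  set μ := expPowerMeasure N b m with hμ
  have hac : μ ≪ volume := withDensity_absolutelyContinuous _ _
  let ε : ℕ → ℝ := fun n => 1 / ((n : ℝ) + 1)
  have hε : ∀ n, 0 < ε n := fun n => by positivity
  let u : ℕ → EuclideanSpace ℝ (Fin N) → ℝ := fun n x => P (‖x‖ ^ 2 + ε n)
  let g : ℕ → EuclideanSpace ℝ (Fin N) → EuclideanSpace ℝ (Fin N) := fun n x =>
    (2 * deriv P (‖x‖ ^ 2 + ε n)) • x
  have hmem : ∀ n, MemH1WithGradient μ (u n) (g n) := fun n =>
    memH1WithGradient_radial hb m hP hP1 (hε n)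
  have hint : ∀ n, Integrable (fun x => u n x ^ 2 / ‖x‖ ^ 2) μ := fun n =>
    (hardy _ _ (hmem n)).1
  -- The negation gives the inequality with `c` for every `u`, hence for all regularized test
  -- functions at once.
  by_contra! hcon
  set B : Set (EuclideanSpace ℝ (Fin N)) := Metric.closedBall 0 1 with hB
  have hBi : Integrable (B.indicator fun _ => M) μ := by
    refine (integrable_indicator_iff Metric.isClosed_closedBall.measurableSet).2
      (integrableOn_const ?_)
    exact ((expPowerMeasure_le_volume hb m B).trans_lt measure_closedBall_lt_top).ne
  have hbound : ∀ n, ∫ x, u n x ^ 2 / ‖x‖ ^ 2 ∂μ ≤ (∫ x, B.indicator (fun _ => M) x ∂μ) / δ :=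
    fun n => by
    have hgi : Integrable (fun x => ‖g n x‖ ^ 2) μ := (hmem n).memLp_grad.integrable_norm_pow
      (by simp)
    have hui : Integrable (fun x => u n x ^ 2) μ := (hmem n).memLp.integrable_sq
    have h1 : ∫ x, (‖g n x‖ ^ 2 + C * u n x ^ 2) ∂μ ≤
        ∫ x, ((l ^ 2 + δ) * (u n x ^ 2 / ‖x‖ ^ 2) + B.indicator (fun _ => M) x) ∂μ := by
      refine integral_mono_ae (hgi.add (hui.const_mul C)) (((hint n).const_mul _).add hBi) ?_
      filter_upwards [hac (Measure.ae_ne volume (0 : EuclideanSpace ℝ (Fin N)))] with x hx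
      have hx0 : 0 < ‖x‖ := norm_pos_iff.2 hx
      have h2 := hineq (‖x‖ ^ 2) (‖x‖ ^ 2 + ε n) (by positivity) (by linarith [hε n])
      have h3 : ‖g n x‖ ^ 2 = 4 * ‖x‖ ^ 2 * deriv P (‖x‖ ^ 2 + ε n) ^ 2 := by
        simp only [g, norm_smul, mul_pow, Real.norm_eq_abs, sq_abs]
        ring
      have h4 : (if ‖x‖ ^ 2 ≤ 1 then M else 0) = B.indicator (fun _ => M) x := by
        have hxB : x ∈ B ↔ ‖x‖ ^ 2 ≤ 1 := by simp [hB]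
        by_cases h : x ∈ B
        · rw [indicator_of_mem h, if_pos (hxB.1 h)]
        · rw [indicator_of_notMem h, if_neg (mt hxB.2 h)]
      rw [h4] at h2
      rw [h3]
      exact h2
    rw [integral_add hgi (hui.const_mul C), integral_add ((hint n).const_mul _) hBi,
      integral_const_mul, integral_const_mul] at h1
    have h5 := hcon _ _ (hmem n) (hint n)
    rw [le_div_iff₀ hδ0]
    have h6 : c = l ^ 2 + 2 * δ := by rw [hδ]; ring
    rw [h6] at h5
    linarith
  have hlim : ∀ᵐ x ∂μ, Tendsto (fun n => u n x ^ 2 / ‖x‖ ^ 2) atTop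
      (𝓝 (P (‖x‖ ^ 2) ^ 2 / ‖x‖ ^ 2)) := by
    filter_upwards [hac (Measure.ae_ne volume (0 : EuclideanSpace ℝ (Fin N)))] with x hx
    have hx0 : 0 < ‖x‖ ^ 2 := by have := norm_pos_iff.2 hx; positivity
    have hPc : ContinuousAt P (‖x‖ ^ 2) := hP.continuousOn.continuousAt (Ioi_mem_nhds hx0)
    exact ((hPc.tendsto.comp (tendsto_add_one_div_nat _)).pow 2).div_const _
  have hI := (integrable_and_integral_le_of_tendsto hint (fun n x => by positivity) hbound hlim).1
  rw [integrable_expPowerMeasure_iff hm] at hI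
  refine not_integrableOn_norm_rpow_neg hN (r := √r) (Real.sqrt_pos.2 hr) ?_
  -- On the ball the weight is at least `e^{-b}`, and the limit `P²/|x|²` equals `|x|^{-2l-2} =
  -- |x|^{-N}`.
  refine (hI.integrableOn.const_mul (Real.exp b)).mono' ?_ ?_
  · exact (measurable_norm.pow_const _).aestronglyMeasurable
  rw [ae_restrict_iff' Metric.isOpen_ball.measurableSet]
  filter_upwards [Measure.ae_ne volume (0 : EuclideanSpace ℝ (Fin N))] with x hx hxr
  have hx0 : 0 < ‖x‖ := norm_pos_iff.2 hx
  have hxr' : ‖x‖ ^ 2 < r := (Real.lt_sqrt hx0.le).1 (by simpa using hxr)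
  rw [Real.norm_of_nonneg (by positivity), hPr _ (by positivity) hxr']
  have h1 : (‖x‖ ^ 2) ^ (-l) / ‖x‖ ^ 2 = ‖x‖ ^ (-(N : ℝ)) := by
    rw [← Real.rpow_natCast, ← Real.rpow_mul hx0.le, ← Real.rpow_sub hx0]
    congr 1
    rw [hl]; push_cast; ring
  rw [h1, ← mul_assoc]
  refine le_mul_of_one_le_left (by positivity) ?_
  calc (1 : ℝ) = Real.exp b * Real.exp (-b) := by rw [← Real.exp_add]; simp
    _ ≤ _ := by
      gcongr
      exact exp_neg_le_sqWeight hm hb (by positivity) (by linarith)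

end Optimality

theorem mainTheorem8 (N : ℕ) (hN : 3 ≤ N) (m b : ℝ) (hm : 0 < m) (hb : 0 ≤ b) :
    (∃ C : ℝ, 0 < C ∧
      ∀ (u : EuclideanSpace ℝ (Fin N) → ℝ)
        (g : EuclideanSpace ℝ (Fin N) → EuclideanSpace ℝ (Fin N)),
        MemH1WithGradient (expPowerMeasure N b m) u g →
          Integrable (fun x => u x ^ 2 / ‖x‖ ^ 2) (expPowerMeasure N b m) ∧
          hardyConst N * ∫ x, u x ^ 2 / ‖x‖ ^ 2 ∂(expPowerMeasure N b m) ≤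
            ∫ x, ‖g x‖ ^ 2 ∂(expPowerMeasure N b m) +
              C * ∫ x, u x ^ 2 ∂(expPowerMeasure N b m)) ∧
    (∀ c : ℝ, hardyConst N < c → ∀ C : ℝ,
      ∃ (u : EuclideanSpace ℝ (Fin N) → ℝ)
        (g : EuclideanSpace ℝ (Fin N) → EuclideanSpace ℝ (Fin N)),
        MemH1WithGradient (expPowerMeasure N b m) u g ∧
          Integrable (fun x => u x ^ 2 / ‖x‖ ^ 2) (expPowerMeasure N b m) ∧
          ∫ x, ‖g x‖ ^ 2 ∂(expPowerMeasure N b m) +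
              C * ∫ x, u x ^ 2 ∂(expPowerMeasure N b m) <
            c * ∫ x, u x ^ 2 / ‖x‖ ^ 2 ∂(expPowerMeasure N b m)) :=
  ⟨exists_hardy_expPowerMeasure hN hm hb, fun _ hc C => exists_hardy_violation hN hm hb hc C⟩
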